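/- **Theorem.** Equip $[0,1]$ with the partial sum $r\oplus s=r+s$ (defined iff $r+s\le 1$), the orthocomplement $r^\bot=1-r$ and the multiplication action of $[0,1]$; this makes it an effect module, and so is $[0,1]^X$, with the pointwise structure, for every set $X$. (An *effect algebra* is a partial commutative monoid $(E,\oplus,0)$ with an operation $(-)^\bot$ such that, with $1=0^\bot$, the element $x^\bot$ is the unique one with $x\oplus x^\bot=1$, and $x\oplus 1$ is defined iff $x=0$. An *effect module* is an effect algebra with an action of the monoid $([0,1],\cdot,1)$ that preserves existing sums in each of its two variables. Morphisms preserve all this structure; $\mathbf{EMod}$ is the category of effect modules.) Let $\mathcal{E}$ be the *expectation monad* on $\mathbf{Set}$, that is, the monad induced by the dual adjunction $$\mathbf{Set}(-,[0,1])\dashv \mathbf{EMod}(-,[0,1])\colon \mathbf{EMod}^{\mathrm{op}}\to\mathbf{Set},$$ so that $\mathcal{E}X=\mathbf{EMod}([0,1]^X,[0,1])$. Let $\mathcal{D}_{\mathsf f}$ be the finite distribution monad on $\mathbf{Set}$, where $\mathcal{D}_{\mathsf f}X$ is the set of finitely supported probability distributions on $X$; let $\mathbf{Kl}_{\mathsf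 f}(\mathcal{D}_{\mathsf f})$ be the full subcategory of its Kleisli category on the finite sets, and let $U_{\mathcal{D}_{\mathsf f}}\colon \mathbf{Kl}_{\mathsf f}(\mathcal{D}_{\mathsf f})\to\mathbf{Set}$ be the forgetful functor, which sends $X$ to $\mathcal{D}_{\mathsf f}X$ and $f\colon X\to\mathcal{D}_{\mathsf f}Y$ to its Kleisli extension $\mathcal{D}_{\mathsf f}X\to\mathcal{D}_{\mathsf f}Y$. Then $\mathcal{E}$ is the codensity monad of $U=U_{\mathcal{D}_{\mathsf f}}$: the right Kan extension $\mathrm{Ran}_U U$ exists and is pointwise, and the codensity monad $(\mathrm{Ran}_U U,\eta,\mu)$ is isomorphic to $\mathcal{E}$ as a monad. (Here, with $\varphi\colon(\mathrm{Ran}_U U)U\to U$ the counit, $\eta$ and $\mu$ correspond under the universal property of $\mathrm{Ran}_U U$ to $\mathrm{id}_U$ and to $\varphi\cdot(\mathrm{Ran}_U U)\varphi$.) -/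

import Mathlib

open CategoryTheory

universe u v w v₁ u₁ v₂ u₂

/-! ### Codensity monads -/

namespace Codensity

noncomputable section

variable {A : Type u₁} {C : Type u₂} [Category.{v₁} A] [Category.{v₂} C]
  (F : A ⥤ C) [F.HasRightKanExtension F]

/-- The underlying endofunctor `Ran_F F` of the codensity monad. -/
abbrev ran : C ⥤ C := F.rightKanExtension F

/-- The counit `φ : (Ran_F F) F ⟶ F`. -/
abbrev counit : F ⋙ ran F ⟶ F := F.rightKanExtensionCounit F

/-- The unit: the transformation `𝟭 ⟶ Ran_F F` that corresponds to `𝟙 : F ⟶ F`. -/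
def unit : 𝟭 C ⟶ ran F :=
  (ran F).liftOfIsRightKanExtension (counit F) (𝟭 C) F.rightUnitor.hom

/-- The multiplication: the transformation `(Ran_F F)(Ran_F F) ⟶ Ran_F F` that corresponds to
`(Ran_F F)(Ran_F F) F ⟶ (Ran_F F) F ⟶ F`, the composite of `(Ran_F F) φ` and `φ`. -/
def mult : ran F ⋙ ran F ⟶ ran F :=
  (ran F).liftOfIsRightKanExtension (counit F) (ran F ⋙ ran F)
    ((F.associator (ran F) (ran F)).inv ≫ Functor.whiskerRight (counit F) (ran F) ≫ counit F)

lemma unit_counit (X : A) :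
    (unit F).app (F.obj X) ≫ (counit F).app X = 𝟙 (F.obj X) := by
  exact (ran F).liftOfIsRightKanExtension_fac_app (counit F) (𝟭 C) F.rightUnitor.hom X

lemma mult_counit (X : A) :
    (mult F).app (F.obj X) ≫ (counit F).app X =
      (ran F).map ((counit F).app X) ≫ (counit F).app X := by
  have h := (ran F).liftOfIsRightKanExtension_fac_app (counit F) (ran F ⋙ ran F)
    ((F.associator (ran F) (ran F)).inv ≫ Functor.whiskerRight (counit F) (ran F) ≫ counit F) X
  simp only [NatTrans.comp_app, Functor.associator_inv_app, Functor.whiskerRight_app] at h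
  exact h.trans (Category.id_comp _)

lemma ran_hom_ext {G : C ⥤ C} (α β : G ⟶ ran F)
    (h : ∀ X, α.app (F.obj X) ≫ (counit F).app X = β.app (F.obj X) ≫ (counit F).app X) :
    α = β := by
  apply F.rightKanExtension_hom_ext F
  ext X
  exact h X

/-- The codensity monad `(Ran_F F, η, μ)` of a functor `F` whose right Kan extension along itself
exists. -/
def monad : Monad C where
  toFunctor := ran F
  η := unit F
  μ := mult F
  assoc X := by
    have h := ran_hom_ext F
      (Functor.whiskerRight (mult F) (ran F) ≫ mult F)
      ((Functor.associator _ _ _).hom ≫ Functor.whiskerLeft (ran F) (mult F) ≫ mult F) (by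
        intro X
        have e := (mult F).naturality ((counit F).app X)
        simp only [Functor.comp_map] at e
        simp only [NatTrans.comp_app, Functor.whiskerRight_app, Functor.whiskerLeft_app,
          Functor.associator_hom_app, Category.assoc, Category.id_comp, mult_counit]
        rw [← Functor.map_comp_assoc, mult_counit, Functor.map_comp_assoc, ← reassoc_of% e,
          mult_counit])
    simpa using! NatTrans.congr_app h X
  left_unit X := by
    have h := ran_hom_ext F
      (Functor.whiskerLeft (ran F) (unit F) ≫ mult F) (ran F).rightUnitor.hom (by
        intro X
        have e := (unit F).naturality ((counit F).app X)
        simp only [Functor.id_map] at e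
        simp only [NatTrans.comp_app, Functor.whiskerLeft_app, Category.assoc, mult_counit]
        erw [← reassoc_of% e, unit_counit]
        simp)
    simpa using! NatTrans.congr_app h X
  right_unit X := by
    have h := ran_hom_ext F
      (Functor.whiskerRight (unit F) (ran F) ≫ mult F) (ran F).leftUnitor.hom (by
        intro X
        simp only [NatTrans.comp_app, Functor.whiskerRight_app, Category.assoc, mult_counit]
        rw [← Functor.map_comp_assoc, unit_counit]
        simp)
    simpa using! NatTrans.congr_app h X

end

end Codensity

/-! ### Effect algebras and effect modules -/

/-- An effect algebra. The partial operation `⊕` is given by its graph: `IsSum a b c` says that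
`a ⊕ b` is defined and equal to `c`. The top element is `1 = 0ᗮ`, that is `orth zero`. -/
class EffectAlgebra (E : Type u) where
  IsSum : E → E → E → Prop
  zero : E
  orth : E → E
  /-- The operation is single-valued. -/
  isSum_unique : ∀ {a b c c'}, IsSum a b c → IsSum a b c' → c = c'
  isSum_comm : ∀ {a b c}, IsSum a b c → IsSum b a c
  /-- If `(a ⊕ b) ⊕ c` is defined, then so is `a ⊕ (b ⊕ c)`, and they agree. -/
  isSum_assoc : ∀ {a b c d e}, IsSum a b d → IsSum d c e → ∃ f, IsSum b c f ∧ IsSum a f e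
  zero_isSum : ∀ a, IsSum zero a a
  /-- `aᗮ` is the unique element with `a ⊕ aᗮ = 1`. -/
  isSum_one_iff : ∀ {a b}, IsSum a b (orth zero) ↔ b = orth a
  /-- `a ⊕ 1` is defined iff `a = 0`. -/
  exists_isSum_one_iff : ∀ {a}, (∃ c, IsSum a (orth zero) c) ↔ a = zero

/-- The effect algebra `[0,1]`: `r ⊕ s = r + s`, defined if `r + s ≤ 1`, and `rᗮ = 1 - r`. -/
instance unitInterval.effectAlgebra : EffectAlgebra unitInterval where
  IsSum r s t := (r : ℝ) + s = t
  zero := 0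
  orth r := unitInterval.symm r
  isSum_unique h h' := Subtype.ext (h.symm.trans h')
  isSum_comm h := by rw [add_comm]; exact h
  isSum_assoc {a b c d e} h h' := by
    have ha := a.2.1
    have hb := b.2.1
    have hc := c.2.1
    have he := e.2.2
    exact ⟨⟨(b : ℝ) + c, by positivity, by linarith⟩, rfl, by simp only; linarith⟩
  zero_isSum a := by simp
  isSum_one_iff {a b} := by
    rw [Subtype.ext_iff]
    simp only [unitInterval.symm_zero, unitInterval.coe_symm_eq, Set.Icc.coe_one]
    constructor <;> intro h <;> linarith
  exists_isSum_one_iff {a} := by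
    rw [Subtype.ext_iff]
    simp only [unitInterval.symm_zero, Set.Icc.coe_one, Set.Icc.coe_zero]
    constructor
    · rintro ⟨c, hc⟩
      linarith [a.2.1, c.2.2]
    · intro h
      exact ⟨1, by simp [h]⟩

/-- An effect module: an effect algebra with an action of the monoid `[0,1]` that is additive in
both variables. -/
class EffectModule (E : Type u) extends EffectAlgebra E where
  act : unitInterval → E → E
  one_act : ∀ a, act 1 a = a
  mul_act : ∀ r s a, act (r * s) a = act r (act s a)
  act_isSum : ∀ r {a b c}, IsSum a b c → IsSum (act r a) (act r b) (act r c)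
  isSum_act : ∀ {r s t : unitInterval} (a), EffectAlgebra.IsSum r s t →
    IsSum (act r a) (act s a) (act t a)

/-- `[0,1]` as an effect module, acting on itself by multiplication. -/
instance unitInterval.effectModule : EffectModule unitInterval where
  act r s := r * s
  one_act := one_mul
  mul_act := mul_assoc
  act_isSum r {a b c} h := by
    change ((r * a : unitInterval) : ℝ) + (r * b : unitInterval) = (r * c : unitInterval)
    change (a : ℝ) + b = c at h
    simp [← h, mul_add]
  isSum_act {r s t} a h := by
    change ((r * a : unitInterval) : ℝ) + (s * a : unitInterval) = (t * a : unitInterval)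
    change (r : ℝ) + s = t at h
    simp [← h, add_mul]

/-- The effect module `[0,1]^X` with the pointwise structure. -/
instance unitInterval.powerEffectModule (X : Type u) : EffectModule (X → unitInterval) where
  IsSum f g h := ∀ x, EffectAlgebra.IsSum (f x) (g x) (h x)
  zero := fun _ => EffectAlgebra.zero
  orth f := fun x => EffectAlgebra.orth (f x)
  isSum_unique h h' := funext fun x => EffectAlgebra.isSum_unique (h x) (h' x)
  isSum_comm h := fun x => EffectAlgebra.isSum_comm (h x)
  isSum_assoc h h' := by
    choose f hf using fun x => EffectAlgebra.isSum_assoc (h x) (h' x)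
    exact ⟨f, fun x => (hf x).1, fun x => (hf x).2⟩
  zero_isSum f := fun x => EffectAlgebra.zero_isSum (f x)
  isSum_one_iff := by
    intro f g
    rw [funext_iff]
    exact forall_congr' fun x => EffectAlgebra.isSum_one_iff
  exists_isSum_one_iff := by
    intro f
    rw [funext_iff, ← Classical.skolem]
    exact forall_congr' fun x => EffectAlgebra.exists_isSum_one_iff
  act r f := fun x => EffectModule.act r (f x)
  one_act f := funext fun x => EffectModule.one_act (f x)
  mul_act r s f := funext fun x => EffectModule.mul_act r s (f x)
  act_isSum r _ _ _ h := fun x => EffectModule.act_isSum r (h x)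
  isSum_act f h := fun x => EffectModule.isSum_act (f x) h

/-- Morphisms of effect modules: maps that preserve the effect algebra structure and the action. -/
@[ext]
structure EffectModuleHom (E : Type u) (E' : Type v) [EffectModule E] [EffectModule E'] where
  toFun : E → E'
  map_isSum : ∀ {a b c : E}, EffectAlgebra.IsSum a b c →
    EffectAlgebra.IsSum (toFun a) (toFun b) (toFun c)
  map_zero : toFun EffectAlgebra.zero = EffectAlgebra.zero
  map_orth : ∀ a, toFun (EffectAlgebra.orth a) = EffectAlgebra.orth (toFun a)
  map_act : ∀ r a, toFun (EffectModule.act r a) = EffectModule.act r (toFun a)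

namespace EffectModuleHom

/-- The identity morphism. -/
def id (E : Type u) [EffectModule E] : EffectModuleHom E E where
  toFun a := a
  map_isSum h := h
  map_zero := rfl
  map_orth _ := rfl
  map_act _ _ := rfl

/-- Composition `g ∘ f` of morphisms. -/
def comp {E : Type u} {E' : Type v} {E'' : Type w}
    [EffectModule E] [EffectModule E'] [EffectModule E'']
    (g : EffectModuleHom E' E'') (f : EffectModuleHom E E') : EffectModuleHom E E'' where
  toFun a := g.toFun (f.toFun a)
  map_isSum h := g.map_isSum (f.map_isSum h)
  map_zero := by rw [f.map_zero, g.map_zero]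
  map_orth a := by rw [f.map_orth, g.map_orth]
  map_act r a := by rw [f.map_act, g.map_act]

/-- Precomposition with `h : X → Y`, as a morphism `[0,1]^Y → [0,1]^X`. -/
def precomp {X : Type u} {Y : Type v} (h : X → Y) :
    EffectModuleHom (Y → unitInterval) (X → unitInterval) where
  toFun f := fun x => f (h x)
  map_isSum hf := fun x => hf (h x)
  map_zero := rfl
  map_orth _ := rfl
  map_act _ _ := rfl

/-- Evaluation at a point `x`, as a morphism `[0,1]^X → [0,1]`. -/
def eval {X : Type u} (x : X) : EffectModuleHom (X → unitInterval) unitInterval where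
  toFun f := f x
  map_isSum h := h x
  map_zero := rfl
  map_orth _ := rfl
  map_act _ _ := rfl

/-- The morphism `E → [0,1]^X` whose components are the morphisms `p x : E → [0,1]`. -/
def pi {E : Type u} [EffectModule E] {X : Type v} (p : X → EffectModuleHom E unitInterval) :
    EffectModuleHom E (X → unitInterval) where
  toFun a := fun x => (p x).toFun a
  map_isSum h := fun x => (p x).map_isSum h
  map_zero := funext fun x => (p x).map_zero
  map_orth a := funext fun x => (p x).map_orth a
  map_act r a := funext fun x => (p x).map_act r a

end EffectModuleHom

/-- The category of effect modules. -/
structure EMod : Type (u + 1) where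
  carrier : Type u
  [str : EffectModule carrier]

attribute [instance] EMod.str

instance EMod.category : Category.{u} EMod.{u} where
  Hom E E' := EffectModuleHom E.carrier E'.carrier
  id E := EffectModuleHom.id E.carrier
  comp f g := EffectModuleHom.comp g f

/-! ### The expectation monad -/

namespace Expectation

/-- The functor `Set(-,[0,1]) : Set ⥤ EModᵒᵖ`. -/
def predicates : Type u ⥤ EMod.{u}ᵒᵖ where
  obj X := Opposite.op (EMod.mk (X → unitInterval))
  map h := Quiver.Hom.op (V := EMod.{u}) (EffectModuleHom.precomp h)

/-- The functor `EMod(-,[0,1]) : EModᵒᵖ ⥤ Set`. -/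
def states : EMod.{u}ᵒᵖ ⥤ Type u where
  obj E := EffectModuleHom E.unop.carrier unitInterval
  map f := ↾fun p => EffectModuleHom.comp p f.unop

/-- The dual adjunction `Set(-,[0,1]) ⊣ EMod(-,[0,1])`, given by transposing a map `E × X → [0,1]`
that is an effect module morphism in the first variable. -/
def adjunction : predicates.{u} ⊣ states.{u} :=
  Adjunction.mkOfHomEquiv
    { homEquiv := fun _ _ =>
        { toFun := fun f => ↾fun x => EffectModuleHom.comp (EffectModuleHom.eval x) f.unop
          invFun := fun p => Quiver.Hom.op (V := EMod.{u}) (EffectModuleHom.pi p)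
          left_inv := fun _ => rfl
          right_inv := fun _ => rfl }
      homEquiv_naturality_left_symm := fun _ _ => rfl
      homEquiv_naturality_right := fun _ _ => rfl }

/-- The expectation monad `X ↦ EMod([0,1]^X,[0,1])` on `Set`, induced by the dual adjunction. -/
def monad : Monad (Type u) := adjunction.{u}.toMonad

end Expectation

/-! ### The finite distribution monad -/

namespace FiniteDistribution

open Convexity

noncomputable section

/-- The monad `D_f` on `Set` of finitely supported probability distributions: the unit is given by
the point masses and the multiplication by averaging, `(μ P)(x) = ∑ p, P(p) p(x)`. -/
def monad : Monad (Type u) where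
  obj X := StdSimplex ℝ X
  map h := ↾(StdSimplex.map h)
  map_id X := by
    refine ConcreteCategory.hom_ext _ _ fun p => ?_
    exact StdSimplex.map_id p
  map_comp f g := by
    refine ConcreteCategory.hom_ext _ _ fun p => ?_
    exact StdSimplex.map_comp p f g
  η :=
    { app := fun X => ↾(fun x : X => StdSimplex.single (R := ℝ) x)
      naturality := fun X Y f => by
        refine ConcreteCategory.hom_ext _ _ fun x => ?_
        exact (StdSimplex.map_single x f).symm }
  μ :=
    { app := fun X => ↾(fun P : StdSimplex ℝ (StdSimplex ℝ X) => P.join)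
      naturality := fun X Y f => by
        refine ConcreteCategory.hom_ext _ _ fun P => ?_
        exact (StdSimplex.map_sConvexComb P f).symm }
  assoc X := by
    refine ConcreteCategory.hom_ext _ _ fun P => ?_
    have h (Q : StdSimplex ℝ (StdSimplex ℝ (StdSimplex ℝ X))) :
        (Q.map StdSimplex.join).join = Q.join.join := (sConvexComb_sConvexComb Q).symm
    exact h P
  left_unit X := by
    refine ConcreteCategory.hom_ext _ _ fun p => ?_
    have h (q : StdSimplex ℝ X) : (StdSimplex.single (R := ℝ) q).join = q := by
      ext : 1
      simp
    exact h p
  right_unit X := by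
    refine ConcreteCategory.hom_ext _ _ fun p => ?_
    change StdSimplex.join (StdSimplex.map (fun x : X => StdSimplex.single (R := ℝ) x) p) = p
    ext : 1
    rw [StdSimplex.weights_join, StdSimplex.weights_map, Finsupp.sum_mapDomain_index
      (by simp) (by intros; rw [add_smul])]
    simp

/-- `Kl_f(D_f)`: the full subcategory of the Kleisli category of `D_f` on the finite sets. -/
abbrev FinKleisli : Type (u + 1) :=
  ObjectProperty.FullSubcategory (C := Kleisli monad.{u}) fun X => Finite X.of

/-- The forgetful functor `U : Kl_f(D_f) ⥤ Set`, sending `X` to `D_f X` and `f : X → D_f Y` to its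
Kleisli extension `D_f X → D_f Y`. -/
def forgetful : FinKleisli.{u} ⥤ Type u :=
  ObjectProperty.ι _ ⋙ Kleisli.Adjunction.fromKleisli monad.{u}

end

end FiniteDistribution

/-!
A distribution `q` on `X` acts on predicates by expectation, `c ↦ ∑ x, q(x) c(x)`, and for finite
`X` every state `[0,1]^X → [0,1]` arises in this way from exactly one `q`. Hence a state `p` on
`D_f X` has a barycenter, the distribution `q` with `𝔼_q[c] = p (r ↦ 𝔼_r[c])`, and barycenters
are the components of the counit `φ : ℰ U ⟶ U`.

An element of the limit that computes `(Ran_U U) Y` assigns to each `h : Y → D_f X` a distribution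
on `X`, compatibly with Kleisli extension. A predicate `f : Y → [0,1]` is the same thing as a map
from `Y` to the distributions on a two-element set, so such a family assigns to it a number, its
expectation. The laws of a state hold because the predicates occurring in any one of them factor
through a single map from `Y` to the distributions on a finite set, where expectation is a state.
-/

namespace Codensity

variable {A : Type u₁} {C : Type u₂} [Category.{v₁} A] [Category.{v₂} C]
  {F : A ⥤ C} [F.HasRightKanExtension F] {T : Monad C} {φ : F ⋙ T.toFunctor ⟶ F}
  {α : T.toFunctor ⟶ ran F}

lemma η_comp_eq_unit (hα : ∀ X, α.app (F.obj X) ≫ (counit F).app X = φ.app X)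
    (hη : ∀ X, T.η.app (F.obj X) ≫ φ.app X = 𝟙 (F.obj X)) : T.η ≫ α = unit F := by
  refine ran_hom_ext F _ _ fun X => ?_
  rw [unit_counit, NatTrans.comp_app, Category.assoc, hα, hη]

lemma μ_comp_eq_whisker_comp_mult
    (hα : ∀ X, α.app (F.obj X) ≫ (counit F).app X = φ.app X)
    (hμ : ∀ X, T.μ.app (F.obj X) ≫ φ.app X = T.map (φ.app X) ≫ φ.app X) :
    T.μ ≫ α =
      Functor.whiskerRight α T.toFunctor ≫ Functor.whiskerLeft (ran F) α ≫ mult F := by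
  refine ran_hom_ext F _ _ fun X => ?_
  have naturality := α.naturality ((counit F).app X)
  simp only [NatTrans.comp_app, Functor.whiskerRight_app, Functor.whiskerLeft_app,
    Category.assoc, mult_counit, hα, hμ]
  rw [← reassoc_of% naturality, hα, ← Functor.map_comp_assoc, hα]

/-- A monad whose underlying endofunctor is a right Kan extension of `F` along itself is the
codensity monad of `F`, provided that its unit and multiplication correspond to `𝟙` and to
`φ ∘ T φ` under the counit `φ`. -/
noncomputable def monadIso (F : A ⥤ C) [F.HasRightKanExtension F] (T : Monad C)
    (φ : F ⋙ T.toFunctor ⟶ F) [T.toFunctor.IsRightKanExtension φ]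
    (hη : ∀ X, T.η.app (F.obj X) ≫ φ.app X = 𝟙 (F.obj X))
    (hμ : ∀ X, T.μ.app (F.obj X) ≫ φ.app X = T.map (φ.app X) ≫ φ.app X) :
    T ≅ monad F :=
  let e : T.toFunctor ≅ ran F := T.toFunctor.rightKanExtensionUnique φ (ran F) (counit F)
  have he (X : A) : e.hom.app (F.obj X) ≫ (counit F).app X = φ.app X := by simp [e]
  MonadIso.mk e (fun X => NatTrans.congr_app (η_comp_eq_unit he hη) X) fun X =>
    (NatTrans.congr_app (μ_comp_eq_whisker_comp_mult he hμ) X).trans (Category.assoc _ _ _).symm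

end Codensity

namespace Expectation

/-- A state on the set `X`: an element of `ℰ X`, that is, a morphism of effect modules
`[0,1]^X → [0,1]`. -/
abbrev State (X : Type u) := EffectModuleHom (X → unitInterval) unitInterval

namespace State

variable {X : Type u} (p : State X)

lemma map_const_one : p.toFun (fun _ => 1) = 1 := by
  have h := p.map_orth EffectAlgebra.zero
  rw [p.map_zero] at h
  simpa [EffectAlgebra.orth, EffectAlgebra.zero] using h

lemma coe_map_sum {ι : Type v} (s : Finset ι) (f : ι → X → unitInterval) {g : X → unitInterval}
    (hg : ∀ x, (g x : ℝ) = ∑ i ∈ s, (f i x : ℝ)) :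
    (p.toFun g : ℝ) = ∑ i ∈ s, (p.toFun (f i) : ℝ) := by
  classical
  induction s using Finset.induction_on generalizing g with
  | empty =>
    obtain rfl : g = EffectAlgebra.zero := funext fun x => Subtype.ext (by rw [hg x]; rfl)
    rw [p.map_zero]
    rfl
  | insert a s ha ih =>
    simp only [Finset.sum_insert ha] at hg ⊢
    have mem_unitInterval (x : X) : ∑ i ∈ s, (f i x : ℝ) ∈ unitInterval :=
      ⟨Finset.sum_nonneg fun i _ => (f i x).2.1, by linarith [hg x, (f a x).2.1, (g x).2.2]⟩
    have isSum : EffectAlgebra.IsSum (f a) (fun x => ⟨_, mem_unitInterval x⟩) g :=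
      fun x => (hg x).symm
    rw [← ih (g := fun x => ⟨_, mem_unitInterval x⟩) fun _ => rfl]
    exact (p.map_isSum isSum).symm

end State

end Expectation

namespace FiniteDistribution

open Convexity Expectation

noncomputable section

section Expectation

variable {X : Type u} {Y : Type v}

lemma iConvexComb_coe_mem_unitInterval (q : StdSimplex ℝ X) (c : X → unitInterval) :
    q.iConvexComb (fun x => (c x : ℝ)) ∈ unitInterval := by
  rw [iConvexComb_eq_sum]
  constructor
  · exact Finset.sum_nonneg fun x _ => mul_nonneg (q.weights_nonneg x) (c x).2.1
  · calc q.weights.sum (fun x r => r * (c x : ℝ))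
        ≤ q.weights.sum fun _ r => r :=
          Finset.sum_le_sum fun x _ => mul_le_of_le_one_right (q.weights_nonneg x) (c x).2.2
      _ = 1 := q.total

/-- The state `c ↦ ∑ x, q(x) c(x)` of a finitely supported distribution `q`. -/
def expectation (q : StdSimplex ℝ X) : State X where
  toFun c := ⟨q.iConvexComb fun x => (c x : ℝ), iConvexComb_coe_mem_unitInterval q c⟩
  map_isSum {a b c} h := by
    change q.iConvexComb _ + q.iConvexComb _ = q.iConvexComb _
    have hc (x : X) : (c x : ℝ) = a x + b x := (h x).symm
    simp [hc, mul_add]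
  map_zero := Subtype.ext (iConvexComb_const q (0 : ℝ))
  map_orth c := Subtype.ext <| by
    simp [EffectAlgebra.orth, mul_sub, Finsupp.sum_sub]
  map_act r c := Subtype.ext <| by
    simp [EffectModule.act, Finsupp.mul_sum, mul_left_comm]

lemma coe_expectation (q : StdSimplex ℝ X) (c : X → unitInterval) :
    ((expectation q).toFun c : ℝ) = q.weights.sum fun x r => r * c x :=
  iConvexComb_eq_sum q _

lemma coe_expectation_of_fintype [Fintype X] (q : StdSimplex ℝ X) (c : X → unitInterval) :
    ((expectation q).toFun c : ℝ) = ∑ x, q.weights x * c x := by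
  rw [coe_expectation, Finsupp.sum_fintype _ _ (by simp)]

lemma expectation_iConvexComb (q : StdSimplex ℝ X) (k : X → StdSimplex ℝ Y)
    (c : Y → unitInterval) :
    (expectation (q.iConvexComb k)).toFun c =
      (expectation q).toFun fun x => (expectation (k x)).toFun c :=
  Subtype.ext (iConvexComb_assoc q k fun y => (c y : ℝ)).symm

lemma coe_expectation_single [DecidableEq X] (q : StdSimplex ℝ X) (x : X) :
    ((expectation q).toFun (Pi.single x 1) : ℝ) = q.weights x := by
  rw [coe_expectation]
  simp +contextual [Pi.single_apply, apply_ite, eq_comm]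

lemma expectation_injective : Function.Injective (expectation : StdSimplex ℝ X → State X) := by
  classical
  intro q q' h
  ext x
  rw [← coe_expectation_single, h, coe_expectation_single]

/-- The distribution on a finite set with weights `w`. -/
def ofWeights [Fintype X] (w : X → unitInterval) (hw : ∑ x, (w x : ℝ) = 1) : StdSimplex ℝ X where
  weights := Finsupp.equivFunOnFinite.symm fun x => (w x : ℝ)
  nonneg x := (w x).2.1
  total := by simpa [Finsupp.sum_fintype] using hw

lemma coe_expectation_ofWeights [Fintype X] (w : X → unitInterval)
    (hw : ∑ x, (w x : ℝ) = 1) (c : X → unitInterval) :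
    ((expectation (ofWeights w hw)).toFun c : ℝ) = ∑ x, (w x * c x : ℝ) :=
  coe_expectation_of_fintype _ _

lemma expectation_surjective [Finite X] :
    Function.Surjective (expectation : StdSimplex ℝ X → State X) := by
  classical
  have := Fintype.ofFinite X
  intro p
  have sum_eq_one : ∑ x, (p.toFun (Pi.single x 1) : ℝ) = 1 := by
    rw [← p.coe_map_sum (g := fun _ => 1) _ _ fun x => by simp [Pi.single_apply, apply_ite],
      p.map_const_one, Set.Icc.coe_one]
  refine ⟨ofWeights (fun x => p.toFun (Pi.single x 1)) sum_eq_one, ?_⟩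
  ext c
  have coe_map_act (x : X) : (p.toFun (EffectModule.act (c x) (Pi.single x 1)) : ℝ) =
      p.toFun (Pi.single x 1) * c x := by
    rw [p.map_act, mul_comm]
    rfl
  rw [coe_expectation_ofWeights, p.coe_map_sum Finset.univ
    (fun x => EffectModule.act (c x) (Pi.single x 1))
    fun y => by simp [EffectModule.act, Pi.single_apply, apply_ite]]
  simp only [coe_map_act]

variable (X) in
/-- Distributions on a finite set are the same thing as states on it. -/
def expectationEquiv [Finite X] : StdSimplex ℝ X ≃ State X :=
  Equiv.ofBijective expectation ⟨expectation_injective, expectation_surjective⟩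

end Expectation

section Barycenter

variable {X : Type u} {Y : Type v} [Finite X]

/-- The barycenter of a state `p` on the distributions on a finite set: the distribution whose
expectation of `c` is the value of `p` at the predicate `q ↦ 𝔼_q[c]`. -/
def barycenter (p : State (StdSimplex ℝ X)) : StdSimplex ℝ X :=
  (expectationEquiv X).symm (p.comp (EffectModuleHom.pi expectation))

lemma expectation_barycenter (p : State (StdSimplex ℝ X)) :
    expectation (barycenter p) = p.comp (EffectModuleHom.pi expectation) :=
  (expectationEquiv X).apply_symm_apply _

lemma barycenter_eval (q : StdSimplex ℝ X) : barycenter (EffectModuleHom.eval q) = q :=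
  expectation_injective (expectation_barycenter _)

lemma barycenter_comp_pi_id (P : State (State (StdSimplex ℝ X))) :
    barycenter (P.comp (EffectModuleHom.pi fun p => p)) =
      barycenter (P.comp (EffectModuleHom.precomp barycenter)) := by
  apply expectation_injective
  ext c : 2
  rw [expectation_barycenter, expectation_barycenter]
  refine congrArg P.toFun (funext fun p => ?_)
  exact congrArg (fun p' => p'.toFun c) (expectation_barycenter p).symm

lemma barycenter_comp_precomp_iConvexComb [Finite Y] (p : State (StdSimplex ℝ X))
    (k : X → StdSimplex ℝ Y) :
    barycenter (p.comp (EffectModuleHom.precomp fun q : StdSimplex ℝ X => q.iConvexComb k)) =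
      (barycenter p).iConvexComb k := by
  apply expectation_injective
  ext c : 2
  rw [expectation_iConvexComb, expectation_barycenter, expectation_barycenter]
  exact congrArg p.toFun (funext fun q => expectation_iConvexComb q k c)

end Barycenter

section Outcomes

lemma sum_ulift_fin {n : ℕ} (f : ULift.{u} (Fin n) → ℝ) : ∑ i, f i = ∑ i, f ⟨i⟩ :=
  (Equiv.ulift.symm.sum_comp f).symm

/-- The distribution on a two-element set with weight `r` at the first point. -/
def coin (r : unitInterval) : StdSimplex ℝ (ULift.{u} (Fin 2)) :=
  ofWeights (fun i => ![r, unitInterval.symm r] i.down) (by simp [sum_ulift_fin])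

/-- The indicator of the first point of a two-element set. -/
def heads (i : ULift.{u} (Fin 2)) : unitInterval :=
  ![1, 0] i.down

lemma expectation_coin_heads (r : unitInterval) : (expectation (coin.{u} r)).toFun heads = r := by
  refine Subtype.ext ?_
  rw [coin, coe_expectation_ofWeights]
  simp [sum_ulift_fin, heads]

lemma coin_expectation_heads (q : StdSimplex ℝ (ULift.{u} (Fin 2))) :
    coin ((expectation q).toFun heads) = q := by
  have sum_weights : q.weights ⟨0⟩ + q.weights ⟨1⟩ = 1 := by
    simpa [Finsupp.sum_fintype, sum_ulift_fin] using q.total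
  have expectation_heads : ((expectation q).toFun heads : ℝ) = q.weights ⟨0⟩ := by
    simp [coe_expectation_of_fintype, sum_ulift_fin, heads]
  ext ⟨i⟩
  fin_cases i
  · exact expectation_heads
  · change 1 - ((expectation q).toFun heads : ℝ) = q.weights ⟨1⟩
    linarith

lemma coin_expectation {X : Type v} (q : StdSimplex ℝ X) (c : X → unitInterval) :
    coin.{u} ((expectation q).toFun c) = q.iConvexComb fun x => coin (c x) := by
  rw [← coin_expectation_heads (q.iConvexComb _), expectation_iConvexComb]
  simp only [expectation_coin_heads]

lemma exists_expectation_eq_of_isSum {Y : Type v} {f g h : Y → unitInterval}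
    (isSum : EffectAlgebra.IsSum f g h) :
    ∃ (t : Y → StdSimplex ℝ (ULift.{u} (Fin 3))) (a b c : ULift.{u} (Fin 3) → unitInterval),
      EffectAlgebra.IsSum a b c ∧ (f = fun y => (expectation (t y)).toFun a) ∧
      (g = fun y => (expectation (t y)).toFun b) ∧ h = fun y => (expectation (t y)).toFun c := by
  have hh (y : Y) : (f y : ℝ) + g y = h y := isSum y
  let t (y : Y) : StdSimplex ℝ (ULift.{u} (Fin 3)) :=
    ofWeights (fun i => ![f y, g y, unitInterval.symm (h y)] i.down)
      (by simp [sum_ulift_fin, Fin.sum_univ_three, hh])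
  refine ⟨t, fun i => ![1, 0, 0] i.down, fun i => ![0, 1, 0] i.down, fun i => ![1, 1, 0] i.down,
    ?_, ?_, ?_, ?_⟩
  · rintro ⟨i⟩
    fin_cases i <;> simp [EffectAlgebra.IsSum]
  all_goals
    ext y
    rw [coe_expectation_ofWeights]
    simp [sum_ulift_fin, Fin.sum_univ_three, hh]

end Outcomes

/-- A choice of a distribution on `X` for each map from `Y` to the distributions on a finite set
`X`, compatible with Kleisli extension (`iConvexComb`). These families are the elements of the limit
that computes `(Ran_U U) Y`, spelled out without reference to `Kl_f(D_f)`. -/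
@[ext]
structure CompatibleFamily (Y : Type u) where
  val : ∀ {X : Type v} [Finite X], (Y → StdSimplex ℝ X) → StdSimplex ℝ X
  val_iConvexComb : ∀ {X X' : Type v} [Finite X] [Finite X'] (h : Y → StdSimplex ℝ X)
    (k : X → StdSimplex ℝ X'), val (fun y => (h y).iConvexComb k) = (val h).iConvexComb k

namespace CompatibleFamily

variable {Y : Type u} (σ : CompatibleFamily.{u, v} Y)

/-- The expectation of a predicate under a compatible family, obtained by viewing the predicate as
a map to the distributions on a two-element set. -/
def expect (f : Y → unitInterval) : unitInterval :=
  (expectation (σ.val fun y => coin (f y))).toFun heads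

lemma expect_expectation {X : Type v} [Finite X] (h : Y → StdSimplex ℝ X)
    (c : X → unitInterval) :
    σ.expect (fun y => (expectation (h y)).toFun c) = (expectation (σ.val h)).toFun c := by
  simp only [expect, coin_expectation, σ.val_iConvexComb, expectation_iConvexComb,
    expectation_coin_heads]

lemma expect_isSum {f g h : Y → unitInterval} (isSum : EffectAlgebra.IsSum f g h) :
    EffectAlgebra.IsSum (σ.expect f) (σ.expect g) (σ.expect h) := by
  obtain ⟨t, a, b, c, isSum', rfl, rfl, rfl⟩ := exists_expectation_eq_of_isSum.{v} isSum
  simp only [expect_expectation]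
  exact (expectation (σ.val t)).map_isSum isSum'

lemma expect_zero : σ.expect EffectAlgebra.zero = EffectAlgebra.zero := by
  have factor : (EffectAlgebra.zero : Y → unitInterval) =
      fun _ => (expectation (coin.{v} 0)).toFun EffectAlgebra.zero :=
    funext fun _ => (expectation _).map_zero.symm
  rw [factor, expect_expectation, EffectModuleHom.map_zero]

lemma expect_orth (f : Y → unitInterval) :
    σ.expect (EffectAlgebra.orth f) = EffectAlgebra.orth (σ.expect f) := by
  have factor : EffectAlgebra.orth f =
      fun y => (expectation (coin.{v} (f y))).toFun (EffectAlgebra.orth heads) := by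
    simp only [EffectModuleHom.map_orth, expectation_coin_heads]
    rfl
  rw [factor, expect_expectation, EffectModuleHom.map_orth, expect]

lemma expect_act (r : unitInterval) (f : Y → unitInterval) :
    σ.expect (EffectModule.act r f) = EffectModule.act r (σ.expect f) := by
  have factor : EffectModule.act r f =
      fun y => (expectation (coin.{v} (f y))).toFun (EffectModule.act r heads) := by
    simp only [EffectModuleHom.map_act, expectation_coin_heads]
    rfl
  rw [factor, expect_expectation, EffectModuleHom.map_act, expect]

/-- The state given by expectation under a compatible family. -/
def toState : State Y where
  toFun := σ.expect
  map_isSum := σ.expect_isSum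
  map_zero := σ.expect_zero
  map_orth := σ.expect_orth
  map_act := σ.expect_act

/-- The compatible family `h ↦ barycenter of the image of p under h`. -/
def ofState (p : State Y) : CompatibleFamily.{u, v} Y where
  val h := barycenter (p.comp (EffectModuleHom.precomp h))
  val_iConvexComb h k :=
    barycenter_comp_precomp_iConvexComb (p.comp (EffectModuleHom.precomp h)) k

lemma toState_ofState (p : State Y) : (ofState.{u, v} p).toState = p := by
  ext f : 2
  change (expectation (barycenter _)).toFun heads = p.toFun f
  rw [expectation_barycenter]
  exact congrArg p.toFun (funext fun y => expectation_coin_heads (f y))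

lemma ofState_toState : ofState σ.toState = σ := by
  ext X _ h : 4
  apply expectation_injective
  ext c : 2
  exact (congrArg (fun p => p.toFun c)
    (expectation_barycenter (σ.toState.comp (EffectModuleHom.precomp h)))).trans
    (σ.expect_expectation h c)

/-- States on `Y` are the same thing as compatible families of distributions. -/
def equivState : CompatibleFamily.{u, v} Y ≃ State Y where
  toFun := toState
  invFun := ofState
  left_inv := ofState_toState
  right_inv := toState_ofState

end CompatibleFamily

/-- The counit `ℰ U ⟶ U`, given by barycenters. -/
def expectationCounit : forgetful.{u} ⋙ Expectation.monad.{u}.toFunctor ⟶ forgetful.{u} where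
  app X := ↾fun p => haveI := X.property; barycenter (X := X.obj.of) p
  naturality X Y k := by
    have := X.property
    have := Y.property
    refine ConcreteCategory.hom_ext _ _ fun p => ?_
    exact barycenter_comp_precomp_iConvexComb (X := X.obj.of) (Y := Y.obj.of) p k.hom.of

lemma η_expectationCounit (X : FinKleisli.{u}) :
    Expectation.monad.{u}.η.app (forgetful.obj X) ≫ expectationCounit.app X =
      𝟙 (forgetful.obj X) := by
  have := X.property
  refine ConcreteCategory.hom_ext _ _ fun q => ?_
  exact barycenter_eval (X := X.obj.of) q

lemma μ_expectationCounit (X : FinKleisli.{u}) :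
    Expectation.monad.{u}.μ.app (forgetful.obj X) ≫ expectationCounit.app X =
      Expectation.monad.{u}.map (expectationCounit.app X) ≫ expectationCounit.app X := by
  have := X.property
  refine ConcreteCategory.hom_ext _ _ fun P => ?_
  exact barycenter_comp_pi_id (X := X.obj.of) P

/-- A finite set as an object of `Kl_f(D_f)`. -/
abbrev finKleisli (X : Type u) [Finite X] : FinKleisli.{u} :=
  ⟨Kleisli.mk _ X, ‹_›⟩

/-- The compatible family given by an element of a cone over the diagram whose limit is
`(Ran_U U) Y`. -/
def familyOfCone {Y : Type u}
    (s : Limits.Cone (StructuredArrow.proj Y forgetful.{u} ⋙ forgetful.{u})) (a : s.pt) :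
    CompatibleFamily.{u, u} Y where
  val {X} _ h := s.π.app (StructuredArrow.mk (Y := finKleisli X) (↾h)) a
  val_iConvexComb {X X'} _ _ h k := by
    let f : finKleisli X ⟶ finKleisli X' := ObjectProperty.homMk ⟨↾k⟩
    let g : StructuredArrow.mk (S := Y) (T := forgetful) (Y := finKleisli X) (↾h) ⟶
        StructuredArrow.mk (S := Y) (T := forgetful) (Y := finKleisli X')
          (↾fun y => ((h y).iConvexComb k : StdSimplex ℝ X')) :=
      StructuredArrow.homMk f rfl
    exact ConcreteCategory.congr_hom (s.w g).symm a

/-- The expectation monad is a pointwise right Kan extension of `U` along itself. -/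
def isPointwiseRightKanExtension :
    (Functor.RightExtension.mk _ expectationCounit.{u}).IsPointwiseRightKanExtension := fun Y =>
  { lift := fun s => ↾fun a => CompatibleFamily.equivState (familyOfCone s a)
    fac := fun s j => by
      have := j.right.property
      refine ConcreteCategory.hom_ext _ _ fun a => ?_
      exact congrArg (fun σ => σ.val (X := j.right.obj.of) j.hom)
        (familyOfCone s a).ofState_toState
    uniq := fun s m hm => by
      refine ConcreteCategory.hom_ext _ _ fun a => ?_
      refine (Equiv.symm_apply_eq CompatibleFamily.equivState).1 ?_
      ext X _ h : 4
      exact ConcreteCategory.congr_hom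
        (hm (StructuredArrow.mk (Y := finKleisli X) (↾h))) a }

end

end FiniteDistribution

/-- The codensity monad of the forgetful functor `U : Kl_f(D_f) ⥤ Set` exists, is pointwise, and is
isomorphic, as a monad, to the expectation monad. -/
theorem theorem6p5 :
    FiniteDistribution.forgetful.{u}.HasPointwiseRightKanExtension
        FiniteDistribution.forgetful.{u} ∧
      ∃ _ : FiniteDistribution.forgetful.{u}.HasRightKanExtension FiniteDistribution.forgetful.{u},
        Nonempty (Expectation.monad.{u} ≅ Codensity.monad FiniteDistribution.forgetful.{u}) := by
  have isPointwise := FiniteDistribution.isPointwiseRightKanExtension.{u}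
  have : Expectation.monad.{u}.toFunctor.IsRightKanExtension
      FiniteDistribution.expectationCounit.{u} := isPointwise.isRightKanExtension
  have hasRan := isPointwise.hasRightKanExtension
  exact ⟨isPointwise.hasPointwiseRightKanExtension, hasRan, ⟨Codensity.monadIso _ _
    FiniteDistribution.expectationCounit.{u} FiniteDistribution.η_expectationCounit
    FiniteDistribution.μ_expectationCounit⟩⟩
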